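/- Let $N\ge 1$, $d_1,\dots,d_N\ge 1$ and $R\ge 1$ be integers, and let $\mathcal H=\bigotimes_{k=1}^N\mathbb C^{d_k}$. States are unit vectors. For a state $|\psi\rangle\in\mathcal H$, let $E_S(|\psi\rangle)=\log r$ be its Schmidt measure, where $r$ is the minimum number of terms in a representation of $|\psi\rangle$ as a linear combination of product states. Let $$|GHZ_N^R\rangle=\frac1{\sqrt R}\sum_{i=0}^{R-1}|i\rangle^{\otimes N}\in(\mathbb C^R)^{\otimes N}$$ be the generalized GHZ state. For a state $|\Phi\rangle\in\mathcal H'=\bigotimes_{k=1}^N\mathbb C^{d'_k}$, regard $\mathcal H'\otimes\mathcal H$ as an $N$-partite system with local subsystems $\mathbb C^{d'_k}\otimes\mathbb C^{d_k}$. The state $|\Phi\rangle$ is called universal for local unambiguous discrimination in $\mathcal H$ if for every set $\{|\psi_1\rangle,\dots,|\psi_D\rangle\}$ of linearly independent states in $\mathcal H$ there are a measurement $\{\Pi_i\}_{i=1}^{D+1}$ on $\mathcal H'\otimes\mathcal H$, $\sum_i\Pi_i=\mathcal I$, that can be implemented by a (finite-round) LOCC protocol, and constants $\epsilon_1,\dots,\epsilon_D>0$,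 with $$\langle\Phi\otimes\psi_j|\,\Pi_i\,|\Phi\otimes\psi_j\rangle=\delta_{ij}\,\epsilon_i\qquad\text{for all } i,j\in\{1,\dots,D\}$$ (the outcome $D+1$ is inconclusive). Then the maximum of $E_S(|\psi\rangle)$ over all states $|\psi\rangle\in\mathcal H$ exists, and $|GHZ_N^R\rangle$ is universal for local unambiguous discrimination in $\mathcal H$ if and only if $$\log R\ \ge\ \max_{|\psi\rangle\in\mathcal H}E_S(|\psi\rangle).$$ -/

import Mathlib

noncomputable section

/-- The `N`-partite space `⨂ₖ ℂ^{d k}`, in coordinates with respect to the standard product basis,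
which is indexed by the tuples `x` with `x k ∈ {0, …, d k - 1}`. -/
abbrev MultiSpace {N : ℕ} (d : Fin N → ℕ) : Type :=
  EuclideanSpace ℂ (∀ k, Fin (d k))

/-- Operators `⨂ₖ ℂ^{d k} → ⨂ₖ ℂ^{d' k}`, as matrices in the standard product bases. -/
abbrev MultiMatrix {N : ℕ} (d' d : Fin N → ℕ) : Type :=
  Matrix (∀ k, Fin (d' k)) (∀ k, Fin (d k)) ℂ

/-- A (pure) state is a unit vector. -/
def IsState {N : ℕ} {d : Fin N → ℕ} (ψ : MultiSpace d) : Prop :=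
  ‖ψ‖ = 1

/-- The product vector `⨂ₖ a k`. -/
def productVector {N : ℕ} {d : Fin N → ℕ} (a : ∀ k, EuclideanSpace ℂ (Fin (d k))) :
    MultiSpace d :=
  WithLp.toLp 2 fun x => ∏ k, a k (x k)

def IsProductState {N : ℕ} {d : Fin N → ℕ} (φ : MultiSpace d) : Prop :=
  IsState φ ∧ ∃ a : ∀ k, EuclideanSpace ℂ (Fin (d k)), φ = productVector a

/-- The Schmidt rank (tensor rank): the least number of terms in a representation of `ψ` as a
linear combination of product states. -/
def schmidtRank {N : ℕ} {d : Fin N → ℕ} (ψ : MultiSpace d) : ℕ :=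
  sInf {n : ℕ | ∃ (c : Fin n → ℂ) (φ : Fin n → MultiSpace d),
    (∀ i, IsProductState (φ i)) ∧ ψ = ∑ i, c i • φ i}

/-- The Schmidt measure, the logarithm of the Schmidt rank. -/
def schmidtMeasure {N : ℕ} {d : Fin N → ℕ} (ψ : MultiSpace d) : ℝ :=
  Real.log (schmidtRank ψ)

/-- The generalized GHZ state `R^{-1/2} ∑ᵢ |i⟩^{⊗N}` in `(ℂ^R)^{⊗N}`. -/
def ghz (N R : ℕ) : MultiSpace (fun _ : Fin N => R) :=
  ((1 / Real.sqrt R : ℝ) : ℂ) •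
    ∑ i : Fin R, productVector fun _ => EuclideanSpace.single i (1 : ℂ)

/-- `Φ ⊗ ψ` for `Φ ∈ ⨂ₖ ℂ^{d' k}` and `ψ ∈ ⨂ₖ ℂ^{d k}`, as a vector of the `N`-partite space
with local subsystems `ℂ^{d' k} ⊗ ℂ^{d k} = ℂ^{d' k * d k}`: the basis vector `|i⟩ ⊗ |j⟩` of the
`k`-th subsystem is the basis vector with number `i * d k + j`, so that `i` and `j` are recovered
as quotient and remainder. -/
def jointState {N : ℕ} {d' d : Fin N → ℕ} (Φ : MultiSpace d') (ψ : MultiSpace d) :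
    MultiSpace (fun k => d' k * d k) :=
  WithLp.toLp 2 fun x => Φ (fun k => (x k).divNat) * ψ (fun k => (x k).modNat)

/-- The product operator `⨂ₗ K l`. -/
def productMatrix {N : ℕ} {d' d : Fin N → ℕ}
    (K : ∀ l, Matrix (Fin (d' l)) (Fin (d l)) ℂ) : MultiMatrix d' d :=
  Matrix.of fun y x => ∏ l, K l (y l) (x l)

/-- LOCC protocols (finitely many rounds) on the `N`-partite system with local dimensions `d`
that end with the announcement of a classical result in `X`. Either the result `x` is announced,
or there is a further round: one party `k` performs a local quantum measurement with finitely many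
outcomes `a` and Kraus operators `K a k`, and broadcasts `a`; given `a`, every other party `l`
applies a local isometry `K a l`, and the protocol continues in a way that may depend on `a`, on
the system with the new local dimensions `d' a`. (Ancillas are attached by isometries. Randomness,
shared or not, arises from Kraus operators proportional to the identity. A subsystem is discarded
by measuring it and ignoring the outcome.) -/
inductive LOCCProtocol {N : ℕ} (X : Type) : (Fin N → ℕ) → Type
  | announce {d : Fin N → ℕ} (x : X) : LOCCProtocol X d
  | round {d : Fin N → ℕ} (k : Fin N) (m : ℕ) (d' : Fin m → Fin N → ℕ)
      (K : ∀ (a : Fin m) (l : Fin N), Matrix (Fin (d' a l)) (Fin (d l)) ℂ)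
      (measurement : ∑ a, (K a k).conjTranspose * K a k = 1)
      (isometry : ∀ a l, l ≠ k → (K a l).conjTranspose * K a l = 1)
      (next : ∀ a, LOCCProtocol X (d' a)) : LOCCProtocol X d

open Classical in
/-- The POVM element `Π_x` that a protocol implements for the result `x`. -/
def LOCCProtocol.effect {N : ℕ} {X : Type} :
    {d : Fin N → ℕ} → LOCCProtocol X d → X → MultiMatrix d d
  | _, .announce x', x => if x' = x then 1 else 0
  | _, .round _ _ _ K _ _ next, x =>
      ∑ a, (productMatrix (K a)).conjTranspose * (next a).effect x * productMatrix (K a)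

/-- The POVM `P`, with elements labelled by `X`, is an LOCC measurement. -/
def IsLOCCMeasurement {N : ℕ} {d : Fin N → ℕ} {X : Type} (P : X → MultiMatrix d d) : Prop :=
  ∃ p : LOCCProtocol X d, ∀ x, P x = p.effect x

/-- The states `χ 0, …, χ (D - 1)` can be unambiguously distinguished with LOCC: some LOCC
measurement with results `some i` (the state is `χ i`) and `none` (inconclusive) satisfies
`⟨χ j| Π_i |χ j⟩ = δ_{ij} ε_i` with every `ε_i` positive. -/
def UnambiguouslyLOCCDistinguishable {N : ℕ} {d : Fin N → ℕ} {D : ℕ}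
    (χ : Fin D → MultiSpace d) : Prop :=
  ∃ P : Option (Fin D) → MultiMatrix d d, IsLOCCMeasurement P ∧
    ∃ ε : Fin D → ℝ, (∀ i, 0 < ε i) ∧
      ∀ i j, inner ℂ (χ j) (WithLp.toLp 2 ((P (some i)).mulVec (χ j).ofLp)) =
        if i = j then (ε i : ℂ) else 0

/-- `Φ` is universal for local unambiguous discrimination in `⨂ₖ ℂ^{d k}`. -/
def IsUniversalForUnambiguousDiscrimination {N : ℕ} {d' : Fin N → ℕ} (Φ : MultiSpace d')
    (d : Fin N → ℕ) : Prop :=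
  ∀ (D : ℕ) (ψ : Fin D → MultiSpace d), (∀ i, IsState (ψ i)) → LinearIndependent ℂ ψ →
    UnambiguouslyLOCCDistinguishable fun i => jointState Φ (ψ i)

end

/-! A product functional on `(ℂ^R)^{⊗N} ⊗ H`, contracted with the GHZ state, becomes a sum of `R`
product functionals on `H`, and every such sum arises
(`productFunctional_dotProduct_jointState_ghz`). Hence GHZ supplies exactly the functionals of
Schmidt rank at most `R`.

Necessity: Kraus operators of LOCC are products, so a conclusive result `i` yields a product
functional that is nonzero on state `i` and zero on the others
(`LOCCProtocol.exists_productFunctional`). For an orthonormal basis containing `ψ`, the contracted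
functional must be a multiple of `⟨ψ|`, whence `ψ` has rank at most `R`.

Sufficiency: dual vectors of the given states have rank at most `R`, so they come from product
functionals. The parties draw `i` at random and project locally onto the factors of the `i`-th one.
-/

open Matrix
open scoped ComplexOrder

/-! ### Product vectors, functionals and operators -/

section ProductVectors

variable {N : ℕ} {d d' d'' : Fin N → ℕ}

/-- The coordinates `x ↦ ∏ₖ φ k (x k)` of a product functional. -/
def productFunctional (φ : ∀ k, Fin (d k) → ℂ) : (∀ k, Fin (d k)) → ℂ :=
  fun x => ∏ k, φ k (x k)

theorem productMatrix_one : productMatrix (fun l => (1 : Matrix (Fin (d l)) (Fin (d l)) ℂ)) = 1 := by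
  ext y x
  simp only [productMatrix, Matrix.of_apply, Matrix.one_apply, Finset.prod_ite_zero,
    Finset.prod_const_one, Finset.mem_univ, true_implies, funext_iff]

theorem productMatrix_mul (K : ∀ l, Matrix (Fin (d'' l)) (Fin (d' l)) ℂ)
    (L : ∀ l, Matrix (Fin (d' l)) (Fin (d l)) ℂ) :
    productMatrix K * productMatrix L = productMatrix fun l => K l * L l := by
  ext y x
  simp only [productMatrix, Matrix.of_apply, Matrix.mul_apply, Finset.prod_univ_sum,
    Fintype.piFinset_univ, Finset.prod_mul_distrib]

theorem productFunctional_vecMul (φ : ∀ k, Fin (d' k) → ℂ)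
    (K : ∀ l, Matrix (Fin (d' l)) (Fin (d l)) ℂ) :
    productFunctional φ ᵥ* productMatrix K = productFunctional fun k => φ k ᵥ* K k := by
  ext x
  simp only [productMatrix, productFunctional, Matrix.of_apply, Matrix.vecMul, dotProduct,
    Finset.prod_univ_sum, Fintype.piFinset_univ, Finset.prod_mul_distrib]

theorem productMatrix_update_smul_one (k : Fin N) (c : ℂ) :
    productMatrix (Function.update
      (fun l => (1 : Matrix (Fin (d l)) (Fin (d l)) ℂ)) k (c • 1)) = c • 1 := by
  rw [← productMatrix_one]
  ext y x
  simp only [productMatrix, Matrix.of_apply, Matrix.smul_apply, smul_eq_mul]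
  rw [← Finset.mul_prod_erase _ _ (Finset.mem_univ k),
    ← Finset.mul_prod_erase (Finset.univ) (fun l => (1 : Matrix (Fin (d l)) (Fin (d l)) ℂ) (y l) (x l))
      (Finset.mem_univ k), ← mul_assoc]
  congr 1
  · simp
  · refine Finset.prod_congr rfl fun l hl => ?_
    rw [Function.update_of_ne (Finset.ne_of_mem_erase hl)]

theorem productVector_update_smul (a : ∀ k, EuclideanSpace ℂ (Fin (d k))) (k : Fin N) (c : ℂ) :
    productVector (Function.update a k (c • a k)) = c • productVector a := by
  ext x
  simp only [productVector, PiLp.smul_apply, smul_eq_mul]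
  rw [← Finset.mul_prod_erase _ _ (Finset.mem_univ k),
    ← Finset.mul_prod_erase (Finset.univ) (fun l => a l (x l))
      (Finset.mem_univ k), ← mul_assoc]
  congr 1
  · simp
  · refine Finset.prod_congr rfl fun l hl => ?_
    rw [Function.update_of_ne (Finset.ne_of_mem_erase hl)]

theorem productVector_single (x : ∀ k, Fin (d k)) :
    productVector (fun k => EuclideanSpace.single (x k) (1 : ℂ)) = EuclideanSpace.single x 1 := by
  ext y
  simp only [productVector, PiLp.single_apply, Finset.prod_ite_zero, Finset.prod_const_one,
    Finset.mem_univ, true_implies, funext_iff]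

theorem isProductState_single (x : ∀ k, Fin (d k)) :
    IsProductState (EuclideanSpace.single x (1 : ℂ) : MultiSpace d) :=
  ⟨by simp [IsState], _, (productVector_single x).symm⟩

end ProductVectors

/-! ### Schmidt rank -/

section SchmidtRank

variable {N : ℕ} {d : Fin N → ℕ}

/-- The normalizing scalar is absorbed into factor `0`, which exists as `N ≥ 1`. -/
theorem exists_isProductState_smul_eq (hN : 1 ≤ N) (hd : ∀ k, 1 ≤ d k)
    (a : ∀ k, EuclideanSpace ℂ (Fin (d k))) :
    ∃ (c : ℂ) (φ : MultiSpace d), IsProductState φ ∧ productVector a = c • φ := by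
  by_cases h : productVector a = 0
  · exact ⟨0, _, isProductState_single fun k => ⟨0, hd k⟩, by simp [h]⟩
  · have h' : (‖productVector a‖ : ℂ) ≠ 0 := by simpa using h
    refine ⟨‖productVector a‖, (‖productVector a‖ : ℂ)⁻¹ • productVector a, ⟨?_, ?_⟩, ?_⟩
    · simpa [IsState] using norm_smul_inv_norm (𝕜 := ℂ) h
    · exact ⟨_, (productVector_update_smul a ⟨0, hN⟩ _).symm⟩
    · rw [smul_inv_smul₀ h']

theorem schmidtRank_le_of_eq_sum (hN : 1 ≤ N) (hd : ∀ k, 1 ≤ d k) {n : ℕ} {ψ : MultiSpace d}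
    (a : Fin n → ∀ k, EuclideanSpace ℂ (Fin (d k))) (h : ψ = ∑ i, productVector (a i)) :
    schmidtRank ψ ≤ n := by
  choose c φ hφ hc using fun i => exists_isProductState_smul_eq hN hd (a i)
  exact Nat.sInf_le ⟨c, φ, hφ, by simpa only [← hc] using h⟩

theorem eq_sum_single (ψ : MultiSpace d) :
    ψ = ∑ i : Fin (Fintype.card (∀ k, Fin (d k))),
      ψ ((Fintype.equivFin _).symm i) •
        (EuclideanSpace.single ((Fintype.equivFin _).symm i) 1 : MultiSpace d) := by
  rw [Equiv.sum_comp (Fintype.equivFin (∀ k, Fin (d k))).symm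
    (fun x => ψ x • (EuclideanSpace.single x 1 : MultiSpace d))]
  ext y
  simp [Pi.single_apply]

theorem schmidtRank_spec (ψ : MultiSpace d) :
    ∃ (c : Fin (schmidtRank ψ) → ℂ) (φ : Fin (schmidtRank ψ) → MultiSpace d),
      (∀ i, IsProductState (φ i)) ∧ ψ = ∑ i, c i • φ i :=
  Nat.sInf_mem (s := {n : ℕ | ∃ (c : Fin n → ℂ) (φ : Fin n → MultiSpace d),
    (∀ i, IsProductState (φ i)) ∧ ψ = ∑ i, c i • φ i})
    ⟨_, _, _, fun _ => isProductState_single _, eq_sum_single ψ⟩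

theorem schmidtRank_le_card (ψ : MultiSpace d) :
    schmidtRank ψ ≤ Fintype.card (∀ k, Fin (d k)) :=
  Nat.sInf_le ⟨_, _, fun _ => isProductState_single _, eq_sum_single ψ⟩

theorem schmidtRank_pos {ψ : MultiSpace d} (hψ : ψ ≠ 0) : 0 < schmidtRank ψ := by
  obtain ⟨c, φ, -, h⟩ := schmidtRank_spec ψ
  by_contra h0
  have : IsEmpty (Fin (schmidtRank ψ)) := ⟨fun i => h0 i.pos⟩
  exact hψ (h.trans (by simp))

theorem eq_sum_productVector_of_schmidtRank_le (hN : 1 ≤ N) {R : ℕ} {ψ : MultiSpace d}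
    (h : schmidtRank ψ ≤ R) :
    ∃ a : Fin R → ∀ k, EuclideanSpace ℂ (Fin (d k)), ψ = ∑ i, productVector (a i) := by
  obtain ⟨c, φ, hφ, hψ⟩ := schmidtRank_spec ψ
  choose _ b hb using hφ
  obtain ⟨m, hm⟩ := Nat.exists_eq_add_of_le h
  rw [hm]
  refine ⟨Fin.append (fun i => Function.update (b i) ⟨0, hN⟩ (c i • b i ⟨0, hN⟩)) 0, ?_⟩
  rw [Fin.sum_univ_add]
  -- Padding terms vanish only because `N ≠ 0`: an empty product would be `1`.
  have h0 : productVector (0 : ∀ k, EuclideanSpace ℂ (Fin (d k))) = 0 := by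
    ext x
    simpa [productVector] using (by omega : N ≠ 0)
  simp only [Fin.append_left, Fin.append_right, productVector_update_smul, ← hb, Pi.zero_apply,
    h0, Finset.sum_const_zero, add_zero]
  exact hψ

theorem exists_maximal_schmidtRank (hd : ∀ k, 1 ≤ d k) :
    ∃ ψ : MultiSpace d, IsState ψ ∧ ∀ χ : MultiSpace d, IsState χ →
      schmidtRank χ ≤ schmidtRank ψ := by
  let s : Set ℕ := {n | ∃ χ : MultiSpace d, IsState χ ∧ schmidtRank χ = n}
  have hs : s.Nonempty := ⟨_, _, (isProductState_single fun k => ⟨0, hd k⟩).1, rfl⟩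
  have hb : BddAbove s := ⟨_, by rintro _ ⟨χ, -, rfl⟩; exact schmidtRank_le_card χ⟩
  obtain ⟨ψ, hψ, h⟩ := Nat.sSup_mem hs hb
  exact ⟨ψ, hψ, fun χ hχ => h ▸ le_csSup hb ⟨χ, hχ, rfl⟩⟩

end SchmidtRank

/-! ### LOCC effects and product functionals -/

section Effects

variable {N : ℕ} {d : Fin N → ℕ}

theorem LOCCProtocol.posSemidef_effect {X : Type} (p : LOCCProtocol X d) (x : X) :
    (p.effect x).PosSemidef := by
  induction p with
  | announce x' =>
    simp only [LOCCProtocol.effect]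
    split_ifs
    · exact Matrix.PosSemidef.one
    · exact Matrix.PosSemidef.zero
  | round k m d' K _ _ next ih =>
    exact Matrix.posSemidef_sum _ fun a _ => (ih a).conjTranspose_mul_mul_same _

theorem star_dotProduct_conjTranspose_mul_mul {m n : Type*} [Fintype m] [Fintype n]
    (A : Matrix m n ℂ) (B : Matrix m m ℂ) (v : n → ℂ) :
    star v ⬝ᵥ ((Aᴴ * B * A) *ᵥ v) = star (A *ᵥ v) ⬝ᵥ (B *ᵥ (A *ᵥ v)) := by
  rw [← mulVec_mulVec, ← mulVec_mulVec, dotProduct_mulVec, star_mulVec]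

/-- If a result of an LOCC protocol can occur on `v`, then some product functional does not vanish
on `v` but vanishes on every vector on which the result cannot occur. -/
theorem LOCCProtocol.exists_productFunctional {X : Type} (p : LOCCProtocol X d) (x : X)
    (v : (∀ k, Fin (d k)) → ℂ) (hv : star v ⬝ᵥ (p.effect x *ᵥ v) ≠ 0) :
    ∃ φ : ∀ k, Fin (d k) → ℂ, productFunctional φ ⬝ᵥ v ≠ 0 ∧
      ∀ u, star u ⬝ᵥ (p.effect x *ᵥ u) = 0 → productFunctional φ ⬝ᵥ u = 0 := by
  induction p with
  | @announce d x' =>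
    simp only [LOCCProtocol.effect] at hv ⊢
    split_ifs at hv ⊢
    · have hv0 : v ≠ 0 := by rintro rfl; simp at hv
      obtain ⟨y, hy⟩ := Function.ne_iff.1 hv0
      have hs : productFunctional (fun k => Pi.single (y k) (1 : ℂ)) = Pi.single y 1 := by
        ext z
        simp only [productFunctional, Pi.single_apply, Finset.prod_ite_zero,
          Finset.prod_const_one, Finset.mem_univ, true_implies, funext_iff]
      -- The effect is the identity, so it vanishes only at `u = 0`; any coordinate with `v y ≠ 0`
      -- serves.
      refine ⟨fun k => Pi.single (y k) 1, by simpa [hs] using hy, fun u hu => ?_⟩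
      rw [one_mulVec, dotProduct_star_self_eq_zero] at hu
      simp [hu]
    · simp at hv
  | @round d k m d' K _ _ next ih =>
    have key : ∀ u, star u ⬝ᵥ ((∑ a, (productMatrix (K a))ᴴ * (next a).effect x *
        productMatrix (K a)) *ᵥ u) = ∑ a, star (productMatrix (K a) *ᵥ u) ⬝ᵥ
          ((next a).effect x *ᵥ (productMatrix (K a) *ᵥ u)) := fun u => by
      rw [sum_mulVec, dotProduct_sum]
      exact Finset.sum_congr rfl fun a _ => star_dotProduct_conjTranspose_mul_mul _ _ _
    simp only [LOCCProtocol.effect, key] at hv ⊢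
    obtain ⟨a, -, ha⟩ := Finset.exists_ne_zero_of_sum_ne_zero hv
    obtain ⟨φ, hφ, hφ'⟩ := ih a _ ha
    -- Pulling back along a product operator keeps the functional a product. Branch terms are
    -- nonnegative, so a zero total forces branch `a` to vanish.
    refine ⟨fun l => φ l ᵥ* K a l, ?_, fun u hu => ?_⟩
    · rwa [← productFunctional_vecMul, ← dotProduct_mulVec]
    · rw [← productFunctional_vecMul, ← dotProduct_mulVec]
      refine hφ' _ ?_
      exact (Finset.sum_eq_zero_iff_of_nonneg
        fun a _ => ((next a).posSemidef_effect x).dotProduct_mulVec_nonneg _).1 hu a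
          (Finset.mem_univ a)

/-- The parties in `S` perform the projective measurements `{P k, 1 - P k}` one after another, and
`x` is announced if all of them succeed. -/
theorem exists_protocol_effect_eq {X : Type} {x : X} {x₀ : X} (hx : x ≠ x₀)
    (P : ∀ k, Matrix (Fin (d k)) (Fin (d k)) ℂ) (hP : ∀ k, (P k)ᴴ = P k)
    (hP2 : ∀ k, P k * P k = P k) (S : Finset (Fin N)) :
    ∃ p : LOCCProtocol X d,
      p.effect x = (productMatrix (S.piecewise P fun _ => 1))ᴴ *
        productMatrix (S.piecewise P fun _ => 1) ∧
      ∀ x', x' ≠ x → x' ≠ x₀ → p.effect x' = 0 := by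
  induction S using Finset.induction_on with
  | empty =>
    refine ⟨.announce x, by simp [LOCCProtocol.effect, productMatrix_one], fun x' h _ => ?_⟩
    simp [LOCCProtocol.effect, h.symm]
  | insert k S hk ih =>
    obtain ⟨p, hp, hp'⟩ := ih
    let K (a : Fin 2) : ∀ l, Matrix (Fin (d l)) (Fin (d l)) ℂ :=
      Function.update (fun _ => 1) k (if a = 0 then P k else 1 - P k)
    have hmul : productMatrix (S.piecewise P fun _ => 1) * productMatrix (K 0) =
        productMatrix ((insert k S).piecewise P fun _ => 1) := by
      rw [productMatrix_mul]
      congr 1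
      funext l
      by_cases h : l = k
      · subst h
        simp [K, hk]
      · by_cases hl : l ∈ S <;> simp [K, h, hl]
    -- Party `k` measures before those in `S`; its failure announces `x₀` at once.
    refine ⟨.round k 2 (fun _ => d) K ?_ ?_ fun a => if a = 0 then p else .announce x₀, ?_,
      fun x' h h0 => ?_⟩
    · simp [K, Fin.sum_univ_two, hP, mul_sub, sub_mul, hP2]
    · intro a l hl
      simp [K, hl]
    · simp only [LOCCProtocol.effect, Fin.sum_univ_two, if_true, one_ne_zero, if_false, hx.symm]
      rw [hp, ← hmul, conjTranspose_mul]
      simp only [mul_zero, zero_mul, add_zero, Matrix.mul_assoc]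
    · simp [LOCCProtocol.effect, Fin.sum_univ_two, hp' x' h h0, h0.symm]

/-- The projection onto the line spanned by `star φ`. -/
theorem rankOne_projection {n : ℕ} {φ : Fin n → ℂ} (hφ : φ ≠ 0) :
    ((φ ⬝ᵥ star φ)⁻¹ • vecMulVec (star φ) φ)ᴴ = (φ ⬝ᵥ star φ)⁻¹ • vecMulVec (star φ) φ ∧
    ((φ ⬝ᵥ star φ)⁻¹ • vecMulVec (star φ) φ) * ((φ ⬝ᵥ star φ)⁻¹ • vecMulVec (star φ) φ) =
      (φ ⬝ᵥ star φ)⁻¹ • vecMulVec (star φ) φ := by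
  have h0 : φ ⬝ᵥ star φ ≠ 0 := fun h => hφ (dotProduct_self_star_eq_zero.1 h)
  constructor
  · rw [conjTranspose_smul, conjTranspose_vecMulVec, star_star, star_inv₀, ← dotProduct_star]
  · rw [smul_mul_smul_comm, vecMulVec_mul_vecMulVec]
    ext i j
    simp [vecMulVec_apply]
    field_simp

/-- Product functionals `φ i` yield an LOCC measurement whose result `i` can occur precisely on the
vectors on which `φ i` does not vanish. -/
theorem exists_protocol_of_productFunctional (hN : 1 ≤ N) {D : ℕ}
    (φ : Fin D → ∀ k, Fin (d k) → ℂ) (hφ : ∀ i k, φ i k ≠ 0) :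
    ∃ (p : LOCCProtocol (Option (Fin D)) d) (A : Fin D → MultiMatrix d d),
      (∀ i, p.effect (some i) = (A i)ᴴ * A i) ∧
      ∀ i u, A i *ᵥ u = 0 ↔ productFunctional (φ i) ⬝ᵥ u = 0 := by
  rcases Nat.eq_zero_or_pos D with rfl | hD
  · exact ⟨.announce none, finZeroElim, finZeroElim, finZeroElim⟩
  let P i k := (φ i k ⬝ᵥ star (φ i k))⁻¹ • vecMulVec (star (φ i k)) (φ i k)
  choose p hp hp' using fun i : Fin D => exists_protocol_effect_eq (Option.some_ne_none i) (P i)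
    (fun k => (rankOne_projection (hφ i k)).1) (fun k => (rankOne_projection (hφ i k)).2)
    Finset.univ
  simp only [Finset.piecewise_univ] at hp
  have hD' : (D : ℝ) ≠ 0 := by positivity
  -- Kraus operators `c • 1` with `D` outcomes realize a uniformly random choice of `i`.
  let c : ℂ := ((√D)⁻¹ : ℝ)
  have hc : star c * c = (D : ℂ)⁻¹ := by
    simp only [c, RCLike.star_def, Complex.conj_ofReal, ← Complex.ofReal_mul, ← mul_inv,
      Real.mul_self_sqrt (Nat.cast_nonneg D)]
    simp
  have hc0 : c ≠ 0 := by
    intro h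
    exact hD.ne' (by simpa [h, eq_comm] using hc)
  refine ⟨.round ⟨0, hN⟩ D (fun _ => d) (fun _ => Function.update (fun _ => 1) ⟨0, hN⟩ (c • 1))
    ?_ ?_ p, fun i => c • productMatrix (P i), fun i => ?_, fun i u => ?_⟩
  · simp only [Function.update_self, conjTranspose_smul, conjTranspose_one, smul_mul_smul_comm, hc,
      mul_one, Finset.sum_const, Finset.card_univ, Fintype.card_fin]
    rw [← Nat.cast_smul_eq_nsmul ℂ, smul_smul, mul_inv_cancel₀ (by exact_mod_cast hD'), one_smul]
  · intro a l hl
    simp [hl]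
  · simp only [LOCCProtocol.effect, productMatrix_update_smul_one]
    rw [Finset.sum_eq_single i]
    · simp [hp]
    · intro j _ hj
      simp [hp' j (some i) (by simpa using hj.symm) (by simp)]
    · simp
  · have hP : productMatrix (P i) = (∏ k, (φ i k ⬝ᵥ star (φ i k))⁻¹) •
        vecMulVec (star (productFunctional (φ i))) (productFunctional (φ i)) := by
      ext y x
      simp [P, productMatrix, productFunctional, vecMulVec_apply, Finset.prod_mul_distrib]
    have h1 : ∏ k, (φ i k ⬝ᵥ star (φ i k))⁻¹ ≠ 0 :=
      Finset.prod_ne_zero_iff.2 fun k _ => inv_ne_zero fun h => hφ i k (dotProduct_self_star_eq_zero.1 h)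
    have h2 : productFunctional (φ i) ≠ 0 := by
      choose y hy using fun k => Function.ne_iff.1 (hφ i k)
      exact Function.ne_iff.2 ⟨y, Finset.prod_ne_zero_iff.2 fun k _ => hy k⟩
    change (c • productMatrix (P i)) *ᵥ u = 0 ↔ _
    rw [hP, smul_mulVec, smul_mulVec, vecMulVec_mulVec]
    rw [smul_eq_zero, or_iff_right hc0, smul_eq_zero, or_iff_right h1]
    simp [h2]

end Effects

/-! ### Contraction with the GHZ state -/

section GHZ

variable {N : ℕ} {d : Fin N → ℕ}

theorem ghz_apply (R : ℕ) (t : Fin N → Fin R) :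
    ghz N R t = ((1 / Real.sqrt R : ℝ) : ℂ) * ∑ i : Fin R, if t = fun _ => i then 1 else 0 := by
  simp only [ghz, productVector_single, PiLp.smul_apply, smul_eq_mul, WithLp.ofLp_sum,
    Finset.sum_apply, PiLp.single_apply]

/-- GHZ is supported on constant tuples, so only the `R` blocks with the same GHZ index `i` at every
party survive. -/
theorem productFunctional_dotProduct_jointState_ghz (R : ℕ) (φ : ∀ k, Fin (R * d k) → ℂ)
    (v : MultiSpace d) :
    productFunctional φ ⬝ᵥ (jointState (ghz N R) v).ofLp = ((1 / Real.sqrt R : ℝ) : ℂ) *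
      (∑ i : Fin R, productFunctional fun k j => φ k (finProdFinEquiv (i, j))) ⬝ᵥ v.ofLp := by
  let e : (∀ k, Fin (R * d k)) ≃ (Fin N → Fin R) × (∀ k, Fin (d k)) :=
    (Equiv.piCongrRight fun _ => finProdFinEquiv.symm).trans (Equiv.arrowProdEquivProdArrow _ _ _)
  have he : productFunctional φ ⬝ᵥ (jointState (ghz N R) v).ofLp =
      ∑ q : (Fin N → Fin R) × (∀ k, Fin (d k)),
        (∏ k, φ k (finProdFinEquiv (q.1 k, q.2 k))) * (ghz N R q.1 * v q.2) := by
    refine Fintype.sum_equiv e _ _ fun z => ?_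
    have hz : ∀ k, finProdFinEquiv ((e z).1 k, (e z).2 k) = z k := fun k =>
      finProdFinEquiv.apply_symm_apply (z k)
    simp only [hz]
    rfl
  rw [he]
  simp only [ghz_apply, Fintype.sum_prod_type, dotProduct, Finset.sum_apply, productFunctional,
    Finset.mul_sum, Finset.sum_mul, mul_ite, ite_mul, mul_one, mul_zero, zero_mul]
  rw [Finset.sum_comm]
  refine Finset.sum_congr rfl fun x _ => ?_
  rw [Finset.sum_comm]
  refine Finset.sum_congr rfl fun i _ => ?_
  rw [Finset.sum_ite_eq']
  simp only [Finset.mem_univ, if_true]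
  ring

end GHZ

/-! ### The two directions -/

section Universality

variable {N : ℕ} {d : Fin N → ℕ}

theorem inner_toLp_mulVec {n : Type*} [Fintype n] (M : Matrix n n ℂ) (u : EuclideanSpace ℂ n) :
    inner ℂ u (WithLp.toLp 2 (M *ᵥ u.ofLp)) = star u.ofLp ⬝ᵥ (M *ᵥ u.ofLp) := by
  rw [EuclideanSpace.inner_eq_star_dotProduct, dotProduct_comm]

theorem exists_orthonormalBasis_of_isState {ψ : MultiSpace d} (hψ : IsState ψ) :
    ∃ (D : ℕ) (b : OrthonormalBasis (Fin D) ℂ (MultiSpace d)) (i : Fin D), b i = ψ := by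
  have ho : Orthonormal ℂ ((↑) : ({ψ} : Set (MultiSpace d)) → MultiSpace d) := by
    rw [orthonormal_iff_ite]
    rintro ⟨_, rfl⟩ ⟨_, rfl⟩
    have h1 : ‖_‖ = 1 := hψ
    simp [inner_self_eq_norm_sq_to_K, h1]
  obtain ⟨u, b, hu, hb⟩ := ho.exists_orthonormalBasis_extension
  let e := Fintype.equivFin u
  exact ⟨_, b.reindex e, e ⟨ψ, hu rfl⟩, by simp [hb]⟩

theorem schmidtRank_le_of_isUniversal (hN : 1 ≤ N) (hd : ∀ k, 1 ≤ d k) {R : ℕ}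
    (h : IsUniversalForUnambiguousDiscrimination (ghz N R) d) {ψ : MultiSpace d}
    (hψ : IsState ψ) : schmidtRank ψ ≤ R := by
  obtain ⟨D, b, i, hi⟩ := exists_orthonormalBasis_of_isState hψ
  obtain ⟨P, ⟨p, hp⟩, ε, hε, hP⟩ := h D b b.orthonormal.1 b.toBasis.linearIndependent
  simp only [hp, inner_toLp_mulVec] at hP
  obtain ⟨φ, hφ, hφ'⟩ := p.exists_productFunctional (some i) (jointState (ghz N R) (b i)).ofLp (by
    rw [hP, if_pos rfl]
    exact_mod_cast (hε i).ne')
  have hj : ∀ j ≠ i, productFunctional φ ⬝ᵥ (jointState (ghz N R) (b j)).ofLp = 0 :=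
    fun j hj => hφ' _ (by rw [hP, if_neg hj.symm])
  simp only [productFunctional_dotProduct_jointState_ghz] at hφ hj
  let f : Fin R → ∀ k, Fin (d k) → ℂ := fun i k j => φ k (finProdFinEquiv (i, j))
  -- `w` is the Riesz vector of the contracted functional; `inner` is conjugate-linear in its first
  -- slot, hence `star`.
  let w : MultiSpace d := ∑ t, productVector fun k => WithLp.toLp 2 (star (f t k))
  have hw : ∀ v : MultiSpace d, inner ℂ w v = (∑ t, productFunctional (f t)) ⬝ᵥ v.ofLp := by
    intro v
    rw [EuclideanSpace.inner_eq_star_dotProduct, dotProduct_comm]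
    congr 1
    ext x
    simp [w, productVector, productFunctional]
  have hwi : inner ℂ w (b i) ≠ 0 := by
    rw [hw]
    exact right_ne_zero_of_mul hφ
  have hwj : ∀ j ≠ i, inner ℂ w (b j) = 0 := fun j hji => by
    rw [hw]
    exact (mul_eq_zero.1 (hj j hji)).resolve_left (left_ne_zero_of_mul hφ)
  have hwψ : w = inner ℂ (b i) w • ψ := by
    rw [← hi]
    conv_lhs => rw [← b.sum_repr' w]
    refine Finset.sum_eq_single i (fun j _ hji => ?_) (by simp)
    rw [inner_eq_zero_symm.1 (hwj j hji), zero_smul]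
  have hc : inner ℂ (b i) w ≠ 0 := fun h0 => hwi (inner_eq_zero_symm.1 h0)
  refine schmidtRank_le_of_eq_sum hN hd (fun t => Function.update
    (fun k => WithLp.toLp 2 (star (f t k))) ⟨0, hN⟩
      ((inner ℂ (b i) w)⁻¹ • WithLp.toLp 2 (star (f t ⟨0, hN⟩)))) ?_
  simp only [productVector_update_smul (fun k => WithLp.toLp 2 (star (f _ k))),
    ← Finset.smul_sum]
  exact (eq_inv_smul_iff₀ hc).2 hwψ.symm

/-- Linearly independent vectors have a dual system. -/
theorem LinearIndependent.exists_dual_vector {E ι : Type*} [NormedAddCommGroup E]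
    [InnerProductSpace ℂ E] [FiniteDimensional ℂ E] {ψ : ι → E} (h : LinearIndependent ℂ ψ)
    (i : ι) : ∃ w : E, ‖w‖ = 1 ∧ inner ℂ w (ψ i) ≠ 0 ∧ ∀ j ≠ i, inner ℂ w (ψ j) = 0 := by
  let S := Submodule.span ℂ (ψ '' {j | j ≠ i})
  have hi : ψ i ∉ S := h.notMem_span_image (by simp)
  -- The part of `ψ i` orthogonal to the span of the others.
  let w := ψ i - S.starProjection (ψ i)
  have hw : w ∈ Sᗮ := S.sub_starProjection_mem_orthogonal (ψ i)
  have hw0 : w ≠ 0 := fun h0 => hi (by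
    rw [sub_eq_zero.1 h0]
    exact S.starProjection_apply_mem _)
  have hwi : inner ℂ w (ψ i) = inner ℂ w w := by
    conv_lhs => rw [← sub_add_cancel (ψ i) (S.starProjection (ψ i))]
    rw [inner_add_right, S.inner_left_of_mem_orthogonal (S.starProjection_apply_mem _) hw, add_zero]
  refine ⟨(‖w‖ : ℂ)⁻¹ • w, norm_smul_inv_norm hw0, ?_, fun j hj => ?_⟩
  · rw [inner_smul_left, hwi]
    exact mul_ne_zero (by simpa using hw0) (inner_self_ne_zero.2 hw0)
  · rw [inner_smul_left,
      S.inner_left_of_mem_orthogonal (Submodule.subset_span ⟨j, hj, rfl⟩) hw, mul_zero]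

theorem isUniversal_ghz_of_schmidtRank_le (hN : 1 ≤ N) {R : ℕ} (hR : 1 ≤ R)
    (h : ∀ ψ : MultiSpace d, IsState ψ → schmidtRank ψ ≤ R) :
    IsUniversalForUnambiguousDiscrimination (ghz N R) d := by
  intro D ψ _ hli
  choose w hw hwi hwj using hli.exists_dual_vector
  choose a ha using fun i => eq_sum_productVector_of_schmidtRank_le hN (h (w i) (hw i))
  -- The GHZ index of `z` selects one of the `R` product terms of `w i`, so the blocks of `φ i` are
  -- the conjugates of these terms.
  let φ : Fin D → ∀ k, Fin (R * d k) → ℂ := fun i k z =>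
    star (a i (finProdFinEquiv.symm z).1 k (finProdFinEquiv.symm z).2)
  have hc : ((1 / Real.sqrt R : ℝ) : ℂ) ≠ 0 := by
    have : (0 : ℝ) < R := by exact_mod_cast hR
    exact_mod_cast (by positivity : (1 / Real.sqrt R : ℝ) ≠ 0)
  have hφ : ∀ i v, productFunctional (φ i) ⬝ᵥ (jointState (ghz N R) v).ofLp = 0 ↔
      inner ℂ (w i) v = 0 := by
    intro i v
    rw [productFunctional_dotProduct_jointState_ghz, mul_eq_zero, or_iff_right hc,
      EuclideanSpace.inner_eq_star_dotProduct, dotProduct_comm, ha i]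
    convert Iff.rfl using 2
    congr 1
    ext x
    simp [φ, productVector, productFunctional, -finProdFinEquiv_symm_apply]
  have hφ0 : ∀ i k, φ i k ≠ 0 := by
    intro i k h0
    refine hwi i ((hφ i _).1 ?_)
    have : productFunctional (φ i) = 0 := by
      ext z
      exact Finset.prod_eq_zero (Finset.mem_univ k) (congrFun h0 _)
    rw [this, zero_dotProduct]
  obtain ⟨p, A, hp, hA⟩ := exists_protocol_of_productFunctional hN φ hφ0
  have hq : ∀ i (u : MultiSpace fun k => R * d k),
      inner ℂ u (WithLp.toLp 2 ((p.effect (some i)).mulVec u.ofLp)) =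
        ((‖(WithLp.toLp 2 (A i *ᵥ u.ofLp) : MultiSpace fun k => R * d k)‖ ^ 2 : ℝ) : ℂ) := by
    intro i u
    rw [inner_toLp_mulVec, hp, ← mulVec_mulVec, dotProduct_mulVec, ← star_mulVec]
    have := inner_self_eq_norm_sq_to_K (𝕜 := ℂ)
      (WithLp.toLp 2 (A i *ᵥ u.ofLp) : MultiSpace fun k => R * d k)
    rw [EuclideanSpace.inner_eq_star_dotProduct, dotProduct_comm] at this
    simpa using this
  refine ⟨p.effect, ⟨p, fun _ => rfl⟩, fun i =>
    ‖(WithLp.toLp 2 (A i *ᵥ (jointState (ghz N R) (ψ i)).ofLp) : MultiSpace fun k => R * d k)‖ ^ 2,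
    fun i => ?_, fun i j => ?_⟩
  · have : A i *ᵥ (jointState (ghz N R) (ψ i)).ofLp ≠ 0 := by
      rw [Ne, hA, hφ]
      exact hwi i
    have h2 : (WithLp.toLp 2 (A i *ᵥ (jointState (ghz N R) (ψ i)).ofLp) :
        MultiSpace fun k => R * d k) ≠ 0 := by simpa using this
    positivity
  · rw [hq]
    split_ifs with hij
    · rw [hij]
    · rw [(hA i _).2 ((hφ i _).2 (hwj i j (Ne.symm hij)))]
      simp

end Universality

theorem mainTheorem7 (N : ℕ) (hN : 1 ≤ N) (d : Fin N → ℕ) (hd : ∀ k, 1 ≤ d k)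
    (R : ℕ) (hR : 1 ≤ R) :
    ∃ M : ℝ, IsGreatest {e : ℝ | ∃ ψ : MultiSpace d, IsState ψ ∧ e = schmidtMeasure ψ} M ∧
      (IsUniversalForUnambiguousDiscrimination (ghz N R) d ↔ M ≤ Real.log R) := by
  obtain ⟨ψ, hψ, hmax⟩ := exists_maximal_schmidtRank hd
  have hpos : ∀ χ : MultiSpace d, IsState χ → (0 : ℝ) < schmidtRank χ := fun χ hχ => by
    refine Nat.cast_pos.2 (schmidtRank_pos ?_)
    rintro rfl
    simp [IsState] at hχ
  refine ⟨schmidtMeasure ψ, ⟨⟨ψ, hψ, rfl⟩, ?_⟩, ?_⟩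
  · rintro _ ⟨χ, hχ, rfl⟩
    exact Real.log_le_log (hpos χ hχ) (Nat.cast_le.2 (hmax χ hχ))
  · rw [schmidtMeasure, Real.log_le_log_iff (hpos ψ hψ) (Nat.cast_pos.2 hR), Nat.cast_le]
    exact ⟨fun h => schmidtRank_le_of_isUniversal hN hd h hψ, fun h =>
      isUniversal_ghz_of_schmidtRank_le hN hR fun χ hχ => (hmax χ hχ).trans h⟩
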